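/- **Conventions.** $I=[0,1]$; spaces of maps carry the compact-open topology; $\mathcal PX$ is the space of paths $I\to X$ and $\mathcal PX(x_1,x_2)$ its subspace of paths from $x_1$ to $x_2$. A path $\alpha$ in $X$ is *well-ended* if for every open $U\ni\alpha$ in $\mathcal PX$ there are open $V_0\ni\alpha(0)$, $V_1\ni\alpha(1)$ in $X$ such that for all $a\in V_0$, $b\in V_1$ some $\beta\in U$ has $\beta(0)=a$, $\beta(1)=b$; it is *locally well-ended* if moreover $\beta$ can always be chosen well-ended. $X$ is *locally wep-connected* if any two points are joined by a locally well-ended path. A *semicovering* of $X$ is a local homeomorphism $p\colon Y\to X$ such that for each $y\in Y$ composition with $p$ gives homeomorphisms $(\mathcal PY)_y\to(\mathcal PX)_{p(y)}$ and $(\Phi Y)_y\to(\Phi X)_{p(y)}$. Here $(\mathcal PX)_x$ is the space of paths starting at $x$, and $(\Phi X)_x$ is the space of maps $\{(s,t)\in I^2: s+t\le 1\}\to X$ that are constantly $x$ on the edge $s=0$. $\mathbf{SCov}(X)$ is the category of semicoverings of $X$ and continuous maps over $X$. $\pi^{\tau}X$ is the fundamental groupoid of $X$ with the finest topologies on its hom-sets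 for which all compositions are jointly continuous, all inversions are continuous, and all maps $\mathcal PX(x_1,x_2)\to\pi X(x_1,x_2)$, $\alpha\mapsto[\alpha]$, are continuous. $\mathbf{TopFunc}(\pi^\tau X,\mathbf{Set})$ is the category of functors $F\colon\pi X\to\mathbf{Set}$ all of whose maps $\pi^\tau X(x_1,x_2)\to\mathbf{Set}(F(x_1),F(x_2))$ are continuous, with natural transformations as morphisms. Here each set (possibly empty) is discrete and $\mathbf{Set}(A,B)$ has the topology of pointwise convergence. *Monodromy* $\mathscr M\colon \mathbf{SCov}(X)\to\mathbf{TopFunc}(\pi^\tau X,\mathbf{Set})$ sends $p$ to the functor $x\mapsto p^{-1}(x)$, $[\alpha]\mapsto(y\mapsto\tilde\alpha_y(1))$, where $\tilde\alpha_y$ is the lift of $\alpha$ starting at $y$, and sends a morphism to its restrictions to the fibres. **Theorem.** Let $X$ be a locally wep-connected space. Then $\mathscr M\colon \mathbf{SCov}(X)\to\mathbf{TopFunc}(\pi^\tau X,\mathbf{Set})$ is an isomorphism of categories, where a set over $X$ is identified, as usual, with the family of its fibres. Explicitly: 1. $\mathscr M$ is an equivalence of categories. 2. Let $\mathbf{SCov}'(X)$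 be the full subcategory of semicoverings presented by their fibres. Its objects are families of sets $(E(x))_{x\in X}$ with a topology on the disjoint union $\coprod_{x\in X}E(x)$ for which the projection to $X$ is a semicovering. Then monodromy $\mathbf{SCov}'(X)\to\mathbf{TopFunc}(\pi^\tau X,\mathbf{Set})$, with the fibre over $x$ identified with $E(x)$ by the canonical bijection, is an isomorphism of categories, that is, fully faithful and bijective on objects. -/

import Mathlib

open CategoryTheory Topology
open scoped unitInterval

universe u

/-! ### Lifting of paths and of homotopies; semicovering maps -/

section Lifting

variable {X Y : Type*} [TopologicalSpace X] [TopologicalSpace Y]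

/-- The space `(PX)_x` of paths in `X` starting at `x`, a subspace of `C(I, X)` with the
compact-open topology. -/
abbrev PathsFrom (X : Type*) [TopologicalSpace X] (x : X) : Type _ :=
  {α : C(I, X) // α 0 = x}

/-- `(PY)_y → (PX)_{p y}`, `α ↦ p ∘ α`. -/
def PathsFrom.map (p : C(Y, X)) (y : Y) (α : PathsFrom Y y) : PathsFrom X (p y) :=
  ⟨p.comp α.1, congrArg p α.2⟩

/-- The 2-simplex `{(s, t) ∈ I² | s + t ≤ 1}`. -/
def simplexTwo : Set (I × I) := {z | (z.1 : ℝ) + (z.2 : ℝ) ≤ 1}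

/-- The space `(ΦX)_x` of maps `φ` from the 2-simplex to `X` that are constantly `x` on the edge
`s = 0` opposite to the vertex `(1, 0)`, with the compact-open topology. Such a `φ` is a homotopy
of paths from `s ↦ φ (s, 0)` to `s ↦ φ (s, 1 - s)`. -/
abbrev HomotopiesFrom (X : Type*) [TopologicalSpace X] (x : X) : Type _ :=
  {φ : C(simplexTwo, X) // ∀ z : simplexTwo, z.1.1 = 0 → φ z = x}

/-- `(ΦY)_y → (ΦX)_{p y}`, `φ ↦ p ∘ φ`. -/
def HomotopiesFrom.map (p : C(Y, X)) (y : Y) (φ : HomotopiesFrom Y y) : HomotopiesFrom X (p y) :=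
  ⟨p.comp φ.1, fun z hz => congrArg p (φ.2 z hz)⟩

/-- A semicovering map: a local homeomorphism with continuous lifting of paths and homotopies. -/
structure IsSemicovering (p : C(Y, X)) : Prop where
  isLocalHomeomorph : IsLocalHomeomorph p
  isHomeomorph_paths : ∀ y : Y, IsHomeomorph (PathsFrom.map p y)
  isHomeomorph_homotopies : ∀ y : Y, IsHomeomorph (HomotopiesFrom.map p y)

end Lifting

/-! ### The category of semicoverings of a space -/

/-- A semicovering of `X`. -/
structure SCov (X : Type u) [TopologicalSpace X] where
  space : Type u
  [top : TopologicalSpace space]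
  proj : C(space, X)
  isSemicovering : IsSemicovering proj

attribute [instance] SCov.top

/-- A morphism of semicoverings of `X`: a continuous map over `X`. -/
@[ext]
structure SCov.Hom {X : Type u} [TopologicalSpace X] (p q : SCov X) where
  toMap : C(p.space, q.space)
  comm : ∀ y, q.proj (toMap y) = p.proj y

instance (X : Type u) [TopologicalSpace X] : Category (SCov X) where
  Hom := SCov.Hom
  id p := ⟨ContinuousMap.id _, fun _ => rfl⟩
  comp f g := ⟨g.toMap.comp f.toMap, fun y => (g.comm _).trans (f.comm y)⟩

/-! ### Categories enriched in topological spaces and the fundamental `Top`-groupoid -/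

/-- A choice of a topology on each hom-set of a category. -/
abbrev HomTopology (C : Type*) [Category C] : Type _ := ∀ x y : C, TopologicalSpace (x ⟶ y)

/-- The topologies on the hom-sets make the groupoid `G` a `Top`-groupoid: composition is jointly
continuous and inversion is continuous. -/
structure IsTopGroupoid {G : Type*} [Groupoid G] (T : HomTopology G) : Prop where
  continuous_comp : ∀ x y z : G,
    @Continuous _ _ (@instTopologicalSpaceProd _ _ (T x y) (T y z)) (T x z)
      (fun f : (x ⟶ y) × (y ⟶ z) => f.1 ≫ f.2)
  continuous_inv : ∀ x y : G,
    @Continuous _ _ (T x y) (T y x) (fun f : x ⟶ y => Groupoid.inv f)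

/-- The reflection of a groupoid with topologized hom-sets into `Top`-groupoids: the finest
topologies on the hom-sets that are coarser than the given ones and make `G` a `Top`-groupoid.
(In Mathlib's order on topologies, `T ≤ S` means that `T` is finer than `S`.) -/
def topReflection {G : Type*} [Groupoid G] (T : HomTopology G) : HomTopology G :=
  sInf {S : HomTopology G | T ≤ S ∧ IsTopGroupoid S}

theorem le_topReflection {G : Type*} [Groupoid G] (T : HomTopology G) : T ≤ topReflection T :=
  le_sInf fun _ hS => hS.1

theorem topReflection_le {G : Type*} [Groupoid G] {T S : HomTopology G} (hTS : T ≤ S)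
    (hS : IsTopGroupoid S) : topReflection T ≤ S :=
  sInf_le ⟨hTS, hS⟩

theorem isTopGroupoid_topReflection {G : Type*} [Groupoid G] (T : HomTopology G) :
    IsTopGroupoid (topReflection T) := by
  have key : ∀ x y : G, topReflection T x y =
      ⨅ S : {S : HomTopology G | T ≤ S ∧ IsTopGroupoid S}, S.1 x y := fun x y => by
    simp only [topReflection, sInf_apply, iInf_apply]
  refine ⟨fun x y z => ?_, fun x y => ?_⟩
  · rw [key x z]
    refine continuous_iInf_rng.2 fun S => ?_
    have h : ∀ a b : G, topReflection T a b ≤ S.1 a b := topReflection_le S.2.1 S.2.2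
    exact continuous_le_dom
      (inf_le_inf (induced_mono (h x y)) (induced_mono (h y z))) (S.2.2.continuous_comp x y z)
  · rw [key y x]
    refine continuous_iInf_rng.2 fun S => ?_
    have h : ∀ a b : G, topReflection T a b ≤ S.1 a b := topReflection_le S.2.1 S.2.2
    exact continuous_le_dom (h x y) (S.2.2.continuous_inv x y)

/-- The hom-sets of the fundamental groupoid as quotients of the path spaces `PX(x, y)`
with the compact-open topology. -/
def piQTop (X : Type*) [TopologicalSpace X] : HomTopology (FundamentalGroupoid X) := fun x y =>
  TopologicalSpace.coinduced
    (Path.Homotopic.Quotient.mk : Path x.as y.as → Path.Homotopic.Quotient x.as y.as) inferInstance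

/-- The hom-topologies of the fundamental `Top`-groupoid of `X`. -/
noncomputable def piTau (X : Type*) [TopologicalSpace X] : HomTopology (FundamentalGroupoid X) :=
  topReflection (piQTop X)

/-- The category of sets as a `Top`-category: every set is discrete and the sets of functions have
the topology of pointwise convergence. -/
def setHomTopology : HomTopology (Type u) := fun A B =>
  TopologicalSpace.induced (fun f : A ⟶ B => (f : A → B))
    (@Pi.topologicalSpace A (fun _ => B) (fun _ => ⊥))

/-- A `Top`-functor: a functor that is continuous on all hom-sets. -/
def IsTopFunctor {C D : Type*} [Category C] [Category D] (T : HomTopology C) (S : HomTopology D)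
    (F : C ⥤ D) : Prop :=
  ∀ x y : C, @Continuous _ _ (T x y) (S (F.obj x) (F.obj y)) (fun f : x ⟶ y => F.map f)

/-- The category of `Top`-functors from the fundamental `Top`-groupoid of `X` to sets,
and natural transformations. -/
abbrev TopFuncPi (X : Type u) [TopologicalSpace X] : Type _ :=
  ObjectProperty.FullSubcategory
    (fun F : FundamentalGroupoid X ⥤ Type u => IsTopFunctor (piTau X) setHomTopology F)

/-! ### Monodromy -/

namespace IsSemicovering

variable {X Y : Type*} [TopologicalSpace X] [TopologicalSpace Y] {p : C(Y, X)}

/-- The lift at `y` of a path starting at `p y`. -/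
noncomputable def lift (hp : IsSemicovering p) {x x' : X} (y : p ⁻¹' {x}) (α : Path x x') :
    C(I, Y) :=
  ((hp.isHomeomorph_paths y.1).homeomorph.symm
    ⟨(α : C(I, X)), α.source.trans (Set.mem_singleton_iff.1 y.2).symm⟩).1

theorem lift_zero (hp : IsSemicovering p) {x x' : X} (y : p ⁻¹' {x}) (α : Path x x') :
    hp.lift y α 0 = y :=
  ((hp.isHomeomorph_paths y.1).homeomorph.symm
    ⟨(α : C(I, X)), α.source.trans (Set.mem_singleton_iff.1 y.2).symm⟩).2

theorem comp_lift (hp : IsSemicovering p) {x x' : X} (y : p ⁻¹' {x}) (α : Path x x') :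
    p.comp (hp.lift y α) = (α : C(I, X)) :=
  congrArg Subtype.val ((hp.isHomeomorph_paths y.1).homeomorph.apply_symm_apply
    ⟨(α : C(I, X)), α.source.trans (Set.mem_singleton_iff.1 y.2).symm⟩)

theorem eq_of_comp_eq (hp : IsSemicovering p) {γ δ : C(I, Y)} (h0 : γ 0 = δ 0)
    (h : p.comp γ = p.comp δ) : γ = δ :=
  congrArg Subtype.val ((hp.isHomeomorph_paths (δ 0)).injective
    (a₁ := ⟨γ, h0⟩) (a₂ := ⟨δ, rfl⟩) (Subtype.ext h))

theorem eq_lift (hp : IsSemicovering p) {x x' : X} (y : p ⁻¹' {x}) (α : Path x x') {γ : C(I, Y)}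
    (h0 : γ 0 = y) (h : ∀ t, p (γ t) = α t) : hp.lift y α = γ :=
  hp.eq_of_comp_eq ((hp.lift_zero y α).trans h0.symm)
    ((hp.comp_lift y α).trans (ContinuousMap.ext fun t => (h t).symm))

/-- The end point of the lift at `y` of `α`, as a point of the fibre over the end point of `α`. -/
noncomputable def liftEnd (hp : IsSemicovering p) {x x' : X} (α : Path x x') (y : p ⁻¹' {x}) :
    p ⁻¹' {x'} :=
  ⟨hp.lift y α 1, (DFunLike.congr_fun (hp.comp_lift y α) 1).trans α.target⟩

theorem liftEnd_eq_of_homotopic (hp : IsSemicovering p) {x x' : X} {α β : Path x x'}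
    (h : α.Homotopic β) (y : p ⁻¹' {x}) : hp.liftEnd α y = hp.liftEnd β y := by
  obtain ⟨H⟩ := h
  have hy : p y.1 = x := y.2
  -- the square maps onto the simplex by collapsing the edge over `1`
  let q : C(I × I, simplexTwo) :=
    ⟨fun z => ⟨(z.1, σ z.1 * z.2), by
      have h1 := z.1.2.1
      have h2 := z.1.2.2
      have h3 := z.2.2.1
      have h4 := z.2.2.2
      simp only [simplexTwo, Set.mem_ofPred_eq, Set.Icc.coe_mul, unitInterval.coe_symm_eq]
      nlinarith⟩, by fun_prop⟩
  have hq : IsQuotientMap q := by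
    refine (q.continuous.isClosedMap).isQuotientMap q.continuous ?_
    rintro ⟨⟨s, t⟩, hst⟩
    have hst' : (s : ℝ) + t ≤ 1 := hst
    by_cases hs : (s : ℝ) = 1
    · refine ⟨(s, 0), Subtype.ext (Prod.ext rfl (Subtype.ext ?_))⟩
      have := t.2.1
      simp [q]
      linarith
    · have hs' : 0 < 1 - (s : ℝ) := sub_pos.2 (lt_of_le_of_ne s.2.2 hs)
      refine ⟨(s, ⟨(t : ℝ) / (1 - s), div_nonneg t.2.1 hs'.le, (div_le_one hs').2 (by linarith)⟩),
        Subtype.ext (Prod.ext rfl (Subtype.ext ?_))⟩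
      simp only [q, ContinuousMap.coe_mk, Set.Icc.coe_mul, unitInterval.coe_symm_eq]
      field_simp
  let K : C(I × I, X) := ⟨fun z => H (z.2, z.1), by fun_prop⟩
  have hK : Function.FactorsThrough K q := by
    rintro ⟨s, r⟩ ⟨s', r'⟩ h
    have h1 : s = s' := congrArg (fun z : simplexTwo => z.1.1) h
    subst h1
    have h2 : (σ s * r : I) = σ s * r' := congrArg (fun z : simplexTwo => z.1.2) h
    by_cases hs : s = 1
    · subst hs
      change H (r, 1) = H (r', 1)
      simp
    · have h3 : ((σ s : I) : ℝ) ≠ 0 := fun h0 => hs (by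
        have : (1 : ℝ) - s = 0 := by simpa using h0
        exact Subtype.ext (by rw [Set.Icc.coe_one]; linarith))
      have h4 : ((σ s : I) : ℝ) * r = (σ s : I) * r' := by
        simpa using congrArg Subtype.val h2
      have : r = r' := Subtype.ext (mul_left_cancel₀ h3 h4)
      rw [this]
  let φ : C(simplexTwo, X) := hq.lift K hK
  have hφ : ∀ z, φ (q z) = H (z.2, z.1) := fun z =>
    DFunLike.congr_fun (hq.lift_comp K hK) z
  have hφ0 : ∀ z : simplexTwo, z.1.1 = 0 → φ z = p y.1 := by
    intro z hz
    obtain ⟨⟨s, r⟩, rfl⟩ := hq.surjective z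
    have : s = 0 := hz
    subst this
    rw [hφ, hy]
    simp
  obtain ⟨Φ, hΦ⟩ := (hp.isHomeomorph_homotopies y.1).surjective ⟨φ, hφ0⟩
  have hΦ' : ∀ z, p (Φ.1 z) = φ z := fun z =>
    DFunLike.congr_fun (congrArg Subtype.val hΦ) z
  have edge : ∀ r : I, Continuous fun s : I => Φ.1 (q (s, r)) := fun r => by fun_prop
  have e0 : hp.lift y α = ⟨_, edge 0⟩ := hp.eq_lift y α (Φ.2 _ rfl) fun t => by
    simp [hΦ', hφ]
  have e1 : hp.lift y β = ⟨_, edge 1⟩ := hp.eq_lift y β (Φ.2 _ rfl) fun t => by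
    simp [hΦ', hφ]
  refine Subtype.ext ?_
  change hp.lift y α 1 = hp.lift y β 1
  rw [e0, e1]
  change Φ.1 (q (1, 0)) = Φ.1 (q (1, 1))
  congr 1
  exact Subtype.ext (Prod.ext rfl (Subtype.ext (by simp [q])))

/-- The function `p⁻¹(x) → p⁻¹(x')`, `y ↦ y · [α]`, given by a homotopy class of paths. -/
noncomputable def transport (hp : IsSemicovering p) {x x' : X}
    (a : Path.Homotopic.Quotient x x') : p ⁻¹' {x} → p ⁻¹' {x'} :=
  _root_.Quotient.lift (s := Path.Homotopic.setoid x x') (fun α => hp.liftEnd α)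
    (fun _ _ h => funext fun y => hp.liftEnd_eq_of_homotopic h y) a

theorem transport_mk (hp : IsSemicovering p) {x x' : X} (α : Path x x') (y : p ⁻¹' {x}) :
    hp.transport (Path.Homotopic.Quotient.mk α) y = hp.liftEnd α y := rfl

theorem transport_refl (hp : IsSemicovering p) {x : X} (y : p ⁻¹' {x}) :
    hp.transport (Path.Homotopic.Quotient.mk (Path.refl x)) y = y := by
  refine Subtype.ext ?_
  change hp.lift y (Path.refl x) 1 = y.1
  rw [hp.eq_lift y (Path.refl x) (γ := ContinuousMap.const I y.1) rfl fun _ => y.2]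
  rfl

theorem transport_trans (hp : IsSemicovering p) {x x' x'' : X}
    (a : Path.Homotopic.Quotient x x') (b : Path.Homotopic.Quotient x' x'') (y : p ⁻¹' {x}) :
    hp.transport (a.trans b) y = hp.transport b (hp.transport a y) := by
  induction a using Path.Homotopic.Quotient.ind with | _ α
  induction b using Path.Homotopic.Quotient.ind with | _ β
  rw [← Path.Homotopic.Quotient.mk_trans]
  simp only [transport_mk]
  set y' := hp.liftEnd α y with hy'
  let γ : Path y.1 y'.1 := ⟨hp.lift y α, hp.lift_zero y α, rfl⟩
  let δ : Path y'.1 (hp.liftEnd β y').1 := ⟨hp.lift y' β, hp.lift_zero y' β, rfl⟩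
  have hγ : ∀ t, p (γ t) = α t := DFunLike.congr_fun (hp.comp_lift y α)
  have hδ : ∀ t, p (δ t) = β t := DFunLike.congr_fun (hp.comp_lift y' β)
  have := hp.eq_lift y (α.trans β) (γ := (γ.trans δ : C(I, Y))) (γ.trans δ).source fun t => by
    change p (γ.trans δ t) = _
    simp only [Path.trans_apply]
    split_ifs <;> simp [hγ, hδ]
  refine Subtype.ext ?_
  change hp.lift y (α.trans β) 1 = _
  rw [this]
  exact (γ.trans δ).target

end IsSemicovering

namespace SCov

variable {X : Type u} [TopologicalSpace X]

/-- The monodromy functor `πX ⥤ Set` of a semicovering: `x ↦ p⁻¹(x)` and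
`[α] ↦ (y ↦ y · [α])`, the end point of the lift of `α` at `y`. -/
noncomputable def monodromyFunctor (p : SCov X) : FundamentalGroupoid X ⥤ Type u where
  obj x := p.proj ⁻¹' {x.as}
  map a := TypeCat.ofHom (p.isSemicovering.transport a)
  map_id x := by
    refine ConcreteCategory.hom_ext _ _ fun y => ?_
    exact p.isSemicovering.transport_refl y
  map_comp a b := by
    refine ConcreteCategory.hom_ext _ _ fun y => ?_
    exact p.isSemicovering.transport_trans a b y

theorem discreteTopology_fiber (p : SCov X) (x : X) : DiscreteTopology (p.proj ⁻¹' {x}) := by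
  have : Subsingleton (p.proj '' (p.proj ⁻¹' {x})) :=
    (Set.subsingleton_singleton.anti (Set.image_preimage_subset _ _)).coe_sort
  exact (p.isSemicovering.isLocalHomeomorph.isLocalHomeomorphOn).discreteTopology_of_image

theorem continuous_liftEnd (p : SCov X) {x x' : X} (y : p.proj ⁻¹' {x}) :
    Continuous fun α : Path x x' => p.isSemicovering.liftEnd α y := by
  have hy : p.proj y.1 = x := y.2
  refine Continuous.subtype_mk (f := fun α : Path x x' => p.isSemicovering.lift y α 1) ?_ _
  have h1 : Continuous fun α : Path x x' =>
      (⟨(α : C(I, X)), α.source.trans hy.symm⟩ : PathsFrom X (p.proj y.1)) :=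
    Continuous.subtype_mk continuous_induced_dom _
  have h2 := continuous_subtype_val.comp
    ((p.isSemicovering.isHomeomorph_paths y.1).homeomorph.symm.continuous.comp h1)
  exact (continuous_eval_const (1 : I)).comp h2

/-- The topology of pointwise convergence, pulled back along a monodromy functor. -/
noncomputable def inducedHomTopology (p : SCov X) : HomTopology (FundamentalGroupoid X) :=
  fun x y => TopologicalSpace.induced (fun a : x ⟶ y => p.monodromyFunctor.map a)
    (setHomTopology _ _)

theorem continuous_inducedHomTopology_iff (p : SCov X) {x y : FundamentalGroupoid X} {Z : Type*}
    [TopologicalSpace Z] {f : Z → (x ⟶ y)} :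
    @Continuous _ _ _ (p.inducedHomTopology x y) f ↔
      ∀ e : p.proj ⁻¹' {x.as}, @Continuous Z (p.proj ⁻¹' {y.as}) _ ⊥
        fun z => p.isSemicovering.transport (f z) e := by
  refine continuous_induced_rng.trans (continuous_induced_rng.trans ?_)
  exact @continuous_pi_iff Z (p.proj ⁻¹' {x.as}) (fun _ => p.proj ⁻¹' {y.as}) _ (fun _ => ⊥) _

/-- The monodromy of a semicovering is a `Top`-functor. -/
theorem isTopFunctor_monodromyFunctor (p : SCov X) :
    IsTopFunctor (piTau X) setHomTopology p.monodromyFunctor := by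
  suffices h : piTau X ≤ p.inducedHomTopology from
    fun x y => continuous_iff_le_induced.2 (h x y)
  have eval : ∀ (x y : FundamentalGroupoid X) (e : p.proj ⁻¹' {x.as}),
      @Continuous _ (p.proj ⁻¹' {y.as}) (p.inducedHomTopology x y) ⊥
        fun a : x ⟶ y => p.isSemicovering.transport a e := fun x y =>
    (@continuous_inducedHomTopology_iff _ _ p x y _ (p.inducedHomTopology x y) id).1
      (@continuous_id _ (p.inducedHomTopology x y))
  refine topReflection_le (fun x y => ?_) ⟨fun x y z => ?_, fun x y => ?_⟩
  · refine continuous_iff_coinduced_le.1 ?_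
    refine p.continuous_inducedHomTopology_iff.2 fun e => ?_
    have := p.continuous_liftEnd (x' := y.as) e
    rwa [(p.discreteTopology_fiber y.as).eq_bot] at this
  · let := p.inducedHomTopology x y
    let := p.inducedHomTopology y z
    refine p.continuous_inducedHomTopology_iff.2 fun e => ?_
    let : TopologicalSpace (p.proj ⁻¹' {y.as}) := ⊥
    let : TopologicalSpace (p.proj ⁻¹' {z.as}) := ⊥
    have : DiscreteTopology (p.proj ⁻¹' {y.as}) := ⟨rfl⟩
    have h : Continuous fun w : (y ⟶ z) × (p.proj ⁻¹' {y.as}) =>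
        p.isSemicovering.transport w.1 w.2 :=
      continuous_prod_of_discrete_right.2 fun e' => eval y z e'
    refine (h.comp (continuous_snd.prodMk ((eval x y e).comp continuous_fst))).congr fun w => ?_
    exact (p.isSemicovering.transport_trans w.1 w.2 e).symm
  · let := p.inducedHomTopology x y
    refine p.continuous_inducedHomTopology_iff.2 fun e => ?_
    let : TopologicalSpace (p.proj ⁻¹' {y.as}) := ⊥
    let : TopologicalSpace (p.proj ⁻¹' {x.as}) := ⊥
    have : DiscreteTopology (p.proj ⁻¹' {x.as}) := ⟨rfl⟩
    have : DiscreteTopology (p.proj ⁻¹' {y.as}) := ⟨rfl⟩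
    refine continuous_discrete_rng.2 fun e' => ?_
    have inv_comp : ∀ a : x ⟶ y, p.isSemicovering.transport a
        (p.isSemicovering.transport (Groupoid.inv a) e) = e := fun a => by
      rw [← p.isSemicovering.transport_trans]
      refine (congrArg (fun b => p.isSemicovering.transport b e) (Groupoid.inv_comp a)).trans ?_
      exact p.isSemicovering.transport_refl e
    have comp_inv : ∀ (a : x ⟶ y) e', p.isSemicovering.transport (Groupoid.inv a)
        (p.isSemicovering.transport a e') = e' := fun a e' => by
      rw [← p.isSemicovering.transport_trans]
      refine (congrArg (fun b => p.isSemicovering.transport b e') (Groupoid.comp_inv a)).trans ?_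
      exact p.isSemicovering.transport_refl e'
    have : (fun a : x ⟶ y => p.isSemicovering.transport (Groupoid.inv a) e) ⁻¹' {e'} =
        (fun a : x ⟶ y => p.isSemicovering.transport a e') ⁻¹' {e} := by
      ext a
      simp only [Set.mem_preimage, Set.mem_singleton_iff]
      exact ⟨fun h => h ▸ inv_comp a, fun h => h ▸ comp_inv a e'⟩
    rw [this]
    exact (isOpen_discrete _).preimage (eval x y e')

end SCov

/-- The end point of a lift is preserved by morphisms of semicoverings. -/
theorem SCov.Hom.map_transport {X : Type u} [TopologicalSpace X] {p q : SCov X} (f : SCov.Hom p q)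
    {x x' : X} (a : Path.Homotopic.Quotient x x') (y : p.proj ⁻¹' {x}) (h h') :
    (⟨f.toMap (p.isSemicovering.transport a y), h'⟩ : q.proj ⁻¹' {x'}) =
      q.isSemicovering.transport a ⟨f.toMap y, h⟩ := by
  induction a using Path.Homotopic.Quotient.ind with | _ α
  refine Subtype.ext ?_
  have : q.isSemicovering.lift ⟨f.toMap y, h⟩ α = f.toMap.comp (p.isSemicovering.lift y α) :=
    q.isSemicovering.eq_lift _ α (congrArg f.toMap (p.isSemicovering.lift_zero y α)) fun t =>
      (f.comm _).trans (DFunLike.congr_fun (p.isSemicovering.comp_lift y α) t)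
  exact (DFunLike.congr_fun this 1).symm

/-- Monodromy, as a functor from the semicoverings of `X` to the `Top`-functors from the
fundamental `Top`-groupoid of `X` to sets. A morphism `f` is sent to its restrictions
to the fibres. -/
noncomputable def monodromy (X : Type u) [TopologicalSpace X] : SCov X ⥤ TopFuncPi X where
  obj p := ⟨p.monodromyFunctor, p.isTopFunctor_monodromyFunctor⟩
  map {p q} f := ObjectProperty.homMk
    { app := fun x => TypeCat.ofHom fun y : p.proj ⁻¹' {x.as} =>
        (⟨f.toMap y, (f.comm y).trans y.2⟩ : q.proj ⁻¹' {x.as})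
      naturality := fun x x' a => by
        refine ConcreteCategory.hom_ext _ _ fun y => ?_
        exact f.map_transport a y _ _ }
  map_id _ := rfl
  map_comp _ _ := rfl

/-! ### Semicoverings presented by their fibres -/

/-- A `Set`-valued functor isomorphic to a `Top`-functor is a `Top`-functor. -/
theorem IsTopFunctor.of_iso {C : Type*} [Category C] {T : HomTopology C} {F G : C ⥤ Type u}
    (hF : IsTopFunctor T setHomTopology F) (i : F ≅ G) : IsTopFunctor T setHomTopology G := by
  intro x y
  let := T x y
  let : TopologicalSpace (F.obj y) := ⊥
  let : TopologicalSpace (G.obj y) := ⊥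
  have : DiscreteTopology (F.obj y) := ⟨rfl⟩
  have hF' := continuous_pi_iff.1 (continuous_induced_rng.1 (hF x y))
  refine continuous_induced_rng.2 (continuous_pi fun e => ?_)
  refine ((continuous_of_discreteTopology (f := fun b => i.hom.app y b)).comp
    (hF' (i.inv.app x e))).congr fun a => ?_
  change i.hom.app y (F.map a (i.inv.app x e)) = G.map a e
  rw [NatTrans.naturality_apply]
  simp

/-- A semicovering of `X` whose underlying map of sets is the projection to `X` of the disjoint
union of a family of sets indexed by the points of `X`. -/
structure SCovFamily (X : Type u) [TopologicalSpace X] where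
  fiber : X → Type u
  top : TopologicalSpace (Σ x, fiber x)
  continuous_fst : Continuous (Sigma.fst : (Σ x, fiber x) → X)
  isSemicovering : IsSemicovering (⟨Sigma.fst, continuous_fst⟩ : C(Σ x, fiber x, X))

namespace SCovFamily

variable {X : Type u} [TopologicalSpace X]

/-- The underlying semicovering. -/
def toSCov (E : SCovFamily X) : SCov X :=
  @SCov.mk X _ (Σ x, E.fiber x) E.top (@ContinuousMap.mk _ _ E.top _ Sigma.fst E.continuous_fst)
    E.isSemicovering

/-- Morphisms are the morphisms of the underlying semicoverings. -/
instance : Category (SCovFamily X) :=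
  inferInstanceAs (Category (InducedCategory (SCov X) toSCov))

/-- The fully faithful inclusion into the category of all semicoverings. -/
def inclusion (X : Type u) [TopologicalSpace X] : SCovFamily X ⥤ SCov X :=
  inducedFunctor toSCov

/-- The canonical bijection from the set `E(x)` to the fibre over `x`, sending `e` to `(x, e)`. -/
def fiberEquiv (E : SCovFamily X) (x : X) : E.fiber x ≃ E.toSCov.proj ⁻¹' {x} where
  toFun e := ⟨⟨x, e⟩, rfl⟩
  invFun y := cast (congrArg E.fiber y.2) y.1.2
  left_inv _ := rfl
  right_inv := by
    rintro ⟨⟨x', e⟩, h⟩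
    obtain rfl : x' = x := h
    rfl

/-- The monodromy functor of the semicovering `E`, with the value at `x` being the set `E(x)`
itself: the fibre over `x` is identified with `E(x)` through the canonical bijection. -/
noncomputable def monodromyFunctor (E : SCovFamily X) : FundamentalGroupoid X ⥤ Type u :=
  E.toSCov.monodromyFunctor.copyObj (fun x => E.fiber x.as)
    (fun x => (E.fiberEquiv x.as).symm.toIso)

/-- The identification of the two versions of the monodromy functor. -/
noncomputable def monodromyFunctorIso (E : SCovFamily X) :
    E.toSCov.monodromyFunctor ≅ E.monodromyFunctor :=
  E.toSCov.monodromyFunctor.isoCopyObj _ _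

/-- `E.monodromyFunctor` as a `Top`-functor. -/
noncomputable def monodromyObj (E : SCovFamily X) : TopFuncPi X :=
  ⟨E.monodromyFunctor, E.toSCov.isTopFunctor_monodromyFunctor.of_iso E.monodromyFunctorIso⟩

/-- Monodromy on semicoverings presented by their fibres: it is the restriction of `monodromy X`
along `inclusion X`, except that the fibre over `x` is replaced by the set `E(x)`,
with which it is in canonical bijection. -/
noncomputable def monodromy (X : Type u) [TopologicalSpace X] : SCovFamily X ⥤ TopFuncPi X :=
  (inclusion X ⋙ _root_.monodromy X).copyObj monodromyObj
    (fun E => ObjectProperty.isoMk _ E.monodromyFunctorIso)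

end SCovFamily

/-! ### Locally wep-connected spaces -/

section Wep

variable {X : Type*} [TopologicalSpace X]

/-- A path `α` is well-ended if for every neighbourhood `U` of `α` in the path space with the
compact-open topology, all `a` near `α(0)` and `b` near `α(1)` are the end points
of a path in `U`. -/
def IsWellEnded (α : C(I, X)) : Prop :=
  ∀ U : Set C(I, X), IsOpen U → α ∈ U → ∃ V₀ V₁ : Set X, IsOpen V₀ ∧ IsOpen V₁ ∧
    α 0 ∈ V₀ ∧ α 1 ∈ V₁ ∧ ∀ a ∈ V₀, ∀ b ∈ V₁, ∃ β ∈ U, β 0 = a ∧ β 1 = b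

/-- A path is locally well-ended if it satisfies the same condition with `β` well-ended. -/
def IsLocallyWellEnded (α : C(I, X)) : Prop :=
  ∀ U : Set C(I, X), IsOpen U → α ∈ U → ∃ V₀ V₁ : Set X, IsOpen V₀ ∧ IsOpen V₁ ∧
    α 0 ∈ V₀ ∧ α 1 ∈ V₁ ∧ ∀ a ∈ V₀, ∀ b ∈ V₁, ∃ β ∈ U, IsWellEnded β ∧ β 0 = a ∧ β 1 = b

/-- Every two points are connected by a locally well-ended path. -/
def LocallyWepConnected (X : Type*) [TopologicalSpace X] : Prop :=
  ∀ x y : X, ∃ α : C(I, X), IsLocallyWellEnded α ∧ α 0 = x ∧ α 1 = y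

end Wep

/-! # Monodromy of semicoverings of a locally wep-connected space

A semicovering is determined by its monodromy for the following reason. Let `y` be a point over `x`
and let `α` be a well-ended path to `x`, lifted so that it ends at `y`. The end point of a lift
depends continuously on the path, and the end points of paths near `α` fill a neighbourhood
of `x`. So the points near `y` are the ends of lifts of paths near `α`. A map over `X` compatible
with monodromy sends ends of lifts to ends of lifts, hence is continuous
(`IsSemicovering.continuous_of_map_liftEnd`). It follows that monodromy is full, and that
the topology of a semicovering presented by its fibres can be recovered from its monodromy.

Conversely, for a `Top`-functor `F` the set `∐ F(x)` is given the finest topology for which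
`α ↦ F[α](e)`, a map from the space of paths with starting point `x` to `∐ F(x)`, is continuous for
all `e ∈ F(x)` (`FundamentalGroupoid.Total`). Continuity of `F` only concerns paths with both ends
fixed, but it controls paths with a moving end point as well: whether `F[β](e) = F[β'](e')` for
paths `β`, `β'` with a common end is decided by the action of the path `β` followed by the reverse
of `β'`, whose ends are fixed. Hence this equality persists for nearby pairs of paths with a
common end (`FundamentalGroupoid.exists_moveAlong_eq`). Together with locally well-ended paths this
produces open sets on which the projection to `X` is injective, and shows that the projection is an
open separated map. Therefore it is a local homeomorphism with unique lifting. Lifts exist and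
depend continuously on the map lifted, since they can be written down: the lift at `e` of a path
`α` is `t ↦ F[α restricted to [0, t]](e)`, and homotopies are lifted along the segments that start
at the edge on which they are constant (`FundamentalGroupoid.isHomeomorph_comp_proj`). The monodromy
of `∐ F(x)` is `F` itself.
-/

/-! ### Paths with fixed starting point -/

section Paths

variable {X : Type*} [TopologicalSpace X]

/-- A path with prescribed starting point, as a `Path` to its own end point. -/
def PathsFrom.toPath {x : X} (α : PathsFrom X x) : Path x (α.1 1) :=
  ⟨α.1, α.2, rfl⟩

theorem PathsFrom.continuous_end {x : X} : Continuous fun α : PathsFrom X x => α.1 1 :=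
  (continuous_eval_const (1 : I)).comp continuous_subtype_val

/-- Pairs of paths with the same end point. -/
abbrev PathCospan (x x' : X) : Type _ :=
  {q : PathsFrom X x × PathsFrom X x' // q.1.1 1 = q.2.1 1}

/-- The path that runs along the first path of a cospan, and back along the second. -/
noncomputable def PathCospan.path {x x' : X} (q : PathCospan x x') : Path x x' :=
  (q.1.1.toPath.cast rfl q.2.symm).trans q.1.2.toPath.symm

theorem PathCospan.continuous_path {x x' : X} :
    Continuous (PathCospan.path : PathCospan x x' → Path x x') := by
  refine Path.continuous_uncurry_iff.1 ?_
  refine Path.trans_continuous_family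
    (fun q : PathCospan x x' => q.1.1.toPath.cast rfl q.2.symm) ?_ (fun q => q.1.2.toPath.symm) ?_
  · change Continuous fun z : PathCospan x x' × I => z.1.1.1.1 z.2
    fun_prop
  · refine Path.symm_continuous_family (fun q : PathCospan x x' => q.1.2.toPath) ?_
    change Continuous fun z : PathCospan x x' × I => z.1.1.2.1 z.2
    fun_prop

theorem IsWellEnded.exists_end {x : X} {α : PathsFrom X x} (hα : IsWellEnded α.1)
    {O : Set (PathsFrom X x)} (hO : IsOpen O) (h : α ∈ O) :
    ∃ V : Set X, IsOpen V ∧ α.1 1 ∈ V ∧ ∀ b ∈ V, ∃ β ∈ O, β.1 1 = b := by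
  obtain ⟨U, hU, rfl⟩ := isOpen_induced_iff.1 hO
  obtain ⟨V₀, V₁, -, hV₁, h0, h1, H⟩ := hα U hU h
  refine ⟨V₁, hV₁, h1, fun b hb => ?_⟩
  obtain ⟨β, hβ, hβ0, hβ1⟩ := H (α.1 0) h0 b hb
  exact ⟨⟨β, hβ0.trans α.2⟩, hβ, hβ1⟩

theorem IsLocallyWellEnded.exists_end {x : X} {α : PathsFrom X x} (hα : IsLocallyWellEnded α.1)
    {O : Set (PathsFrom X x)} (hO : IsOpen O) (h : α ∈ O) :
    ∃ V : Set X, IsOpen V ∧ α.1 1 ∈ V ∧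
      ∀ b ∈ V, ∃ β ∈ O, IsWellEnded β.1 ∧ β.1 1 = b := by
  obtain ⟨U, hU, rfl⟩ := isOpen_induced_iff.1 hO
  obtain ⟨V₀, V₁, -, hV₁, h0, h1, H⟩ := hα U hU h
  refine ⟨V₁, hV₁, h1, fun b hb => ?_⟩
  obtain ⟨β, hβ, hβw, hβ0, hβ1⟩ := H (α.1 0) h0 b hb
  exact ⟨⟨β, hβ0.trans α.2⟩, hβ, hβw, hβ1⟩

theorem IsLocallyWellEnded.isWellEnded {α : C(I, X)} (hα : IsLocallyWellEnded α) :
    IsWellEnded α := fun U hU h => by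
  obtain ⟨V₀, V₁, hV₀, hV₁, h0, h1, H⟩ := hα U hU h
  refine ⟨V₀, V₁, hV₀, hV₁, h0, h1, fun a ha b hb => ?_⟩
  obtain ⟨β, hβ, -, hβ'⟩ := H a ha b hb
  exact ⟨β, hβ, hβ'⟩

end Paths

/-! ### Fibrewise maps of semicoverings that respect lifts -/

section Fullness

variable {X : Type*} [TopologicalSpace X]

namespace IsSemicovering

variable {Y : Type*} [TopologicalSpace Y] {p : C(Y, X)}

theorem continuous_liftEnd_toPath (hp : IsSemicovering p) {x : X} (y : p ⁻¹' {x}) :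
    Continuous fun α : PathsFrom X x => (hp.liftEnd α.toPath y : Y) := by
  obtain ⟨y, rfl⟩ := y
  exact PathsFrom.continuous_end.comp (hp.isHomeomorph_paths y).homeomorph.symm.continuous

theorem liftEnd_symm_liftEnd (hp : IsSemicovering p) {x x' : X} (α : Path x x')
    (y : p ⁻¹' {x'}) : hp.liftEnd α (hp.liftEnd α.symm y) = y := by
  simp only [← transport_mk, ← transport_trans, ← Path.Homotopic.Quotient.mk_trans]
  rw [Path.Homotopic.Quotient.mk_trans, Path.Homotopic.Quotient.mk_symm,
    Path.Homotopic.Quotient.symm_trans]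
  exact hp.transport_refl y

/-- A map over `X` between semicoverings that respects the end points of lifted paths is
continuous. Near a point `y`, both it and its image are end points of lifts of paths close to a
well-ended path, and the end points of lifts depend continuously on the path. -/
theorem continuous_of_map_liftEnd (hX : LocallyWepConnected X) {Z : Type*} [TopologicalSpace Z]
    {q : C(Z, X)} (hp : IsSemicovering p) (hq : IsSemicovering q) {f : Y → Z}
    (hf : ∀ y, q (f y) = p y)
    (h : ∀ (x x' : X) (α : Path x x') (y : p ⁻¹' {x}),
      f (hp.liftEnd α y) = hq.liftEnd α ⟨f y, (hf y).trans y.2⟩) : Continuous f := by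
  refine continuous_iff_continuousAt.2 fun y => ?_
  obtain ⟨α, hα, hα0, hα1⟩ := hX (p y) (p y)
  let y₀ : p ⁻¹' {p y} := hp.liftEnd (Path.symm ⟨α, hα0, hα1⟩) ⟨y, rfl⟩
  let a : PathsFrom X (p y) := ⟨α, hα0⟩
  have ha : (hp.liftEnd a.toPath y₀ : Y) = y := by
    have key : ∀ (x' : X) (γ : Path (p y) x') (w : p ⁻¹' {x'}), (α = γ) →
        (hp.liftEnd a.toPath (hp.liftEnd γ.symm w) : Y) = w := by
      rintro x' γ w hγ
      obtain rfl : α 1 = x' := by rw [hγ]; exact γ.target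
      have : γ = a.toPath := Path.ext (funext fun t => (DFunLike.congr_fun hγ t).symm)
      rw [this, liftEnd_symm_liftEnd]
    exact key _ ⟨α, hα0, hα1⟩ ⟨y, rfl⟩ rfl
  have hfl : ∀ β : PathsFrom X (p y), f (hp.liftEnd β.toPath y₀) =
      hq.liftEnd β.toPath ⟨f y₀, (hf y₀).trans y₀.2⟩ := fun β => h _ _ _ _
  refine fun W hW => Filter.mem_map.2 ?_
  obtain ⟨W', hW'W, hW', hyW'⟩ := mem_nhds_iff.1 hW
  obtain ⟨e, hye, hpe⟩ := hp.isLocalHomeomorph y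
  -- the paths whose lift to `Y` ends in the sheet of `y` and whose lift to `Z` ends in `W'`
  let O : Set (PathsFrom X (p y)) := {β | (hp.liftEnd β.toPath y₀ : Y) ∈ e.source} ∩
    {β | (hq.liftEnd β.toPath ⟨f y₀, (hf y₀).trans y₀.2⟩ : Z) ∈ W'}
  have hO : IsOpen O := (e.open_source.preimage (hp.continuous_liftEnd_toPath y₀)).inter
    (hW'.preimage (hq.continuous_liftEnd_toPath _))
  have haO : a ∈ O := by
    refine ⟨?_, ?_⟩
    · change (hp.liftEnd a.toPath y₀ : Y) ∈ e.source
      rwa [ha]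
    · change (hq.liftEnd a.toPath _ : Z) ∈ W'
      rwa [← hfl, ha]
  obtain ⟨V, hV, hVa, H⟩ := IsWellEnded.exists_end hα.isWellEnded hO haO
  have hyV : p y ∈ V := by rw [← hα1]; exact hVa
  filter_upwards [e.open_source.mem_nhds hye, (hV.preimage p.continuous).mem_nhds hyV]
    with y' hy'e hy'V
  obtain ⟨β, ⟨hβ1, hβ2⟩, hβ⟩ := H _ hy'V
  have : (hp.liftEnd β.toPath y₀ : Y) = y' := by
    refine e.injOn hβ1 hy'e ?_
    rw [← hpe]
    exact (hp.liftEnd β.toPath y₀).2.trans hβ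
  refine hW'W ?_
  rw [← this, hfl]
  exact hβ2

end IsSemicovering

end Fullness

/-! ### The action of paths on the values of a functor on the fundamental groupoid -/

namespace FundamentalGroupoid

variable {X : Type u} [TopologicalSpace X] (F : FundamentalGroupoid X ⥤ Type u)

/-- The function `F(x) → F(x')` given by the homotopy class of a path. -/
def act {x x' : X} (α : Path x x') (e : F.obj ⟨x⟩) : F.obj ⟨x'⟩ :=
  F.map (X := ⟨x⟩) (Y := ⟨x'⟩) (Path.Homotopic.Quotient.mk α) e

theorem act_refl {x : X} (e : F.obj ⟨x⟩) : act F (Path.refl x) e = e :=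
  Functor.map_id_apply F ⟨x⟩ e

theorem act_trans {x x' x'' : X} (α : Path x x') (β : Path x' x'') (e : F.obj ⟨x⟩) :
    act F (α.trans β) e = act F β (act F α e) :=
  Functor.map_comp_apply F (X := ⟨x⟩) (Y := ⟨x'⟩) (Z := ⟨x''⟩) (Path.Homotopic.Quotient.mk α)
    (Path.Homotopic.Quotient.mk β) e

theorem act_congr {x x' : X} {α β : Path x x'} (h : α.Homotopic β) (e : F.obj ⟨x⟩) :
    act F α e = act F β e := by
  rw [act, act, Path.Homotopic.Quotient.eq.2 h]

theorem act_symm_act {x x' : X} (α : Path x x') (e : F.obj ⟨x⟩) :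
    act F α.symm (act F α e) = e := by
  rw [← act_trans, ← act_congr F ⟨Path.Homotopy.reflTransSymm α⟩, act_refl]

theorem act_act_symm {x x' : X} (α : Path x x') (e : F.obj ⟨x'⟩) :
    act F α (act F α.symm e) = e := by
  simpa using act_symm_act F α.symm e

theorem act_injective {x x' : X} (α : Path x x') : Function.Injective (act F α) :=
  Function.LeftInverse.injective (act_symm_act F α)

variable {F} in
theorem isOpen_act_eq (hF : IsTopFunctor (piTau X) setHomTopology F) {x x' : X} (e : F.obj ⟨x⟩)
    (e' : F.obj ⟨x'⟩) : IsOpen {α : Path x x' | act F α e = e'} := by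
  let : TopologicalSpace (F.obj ⟨x'⟩) := ⊥
  have : DiscreteTopology (F.obj ⟨x'⟩) := ⟨rfl⟩
  let := piTau X ⟨x⟩ ⟨x'⟩
  have h1 : Continuous fun a : (⟨x⟩ : FundamentalGroupoid X) ⟶ ⟨x'⟩ => F.map a e :=
    continuous_pi_iff.1 (continuous_induced_rng.1 (hF ⟨x⟩ ⟨x'⟩)) e
  have h2 : Continuous fun α : Path x x' =>
      (Path.Homotopic.Quotient.mk α : (⟨x⟩ : FundamentalGroupoid X) ⟶ ⟨x'⟩) :=
    continuous_iff_coinduced_le.2 (le_topReflection (piQTop X) ⟨x⟩ ⟨x'⟩)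
  exact (isOpen_discrete {e'}).preimage (h1.comp h2)

/-- The disjoint union of the values of `F`. -/
def Total : Type u := Σ x : X, F.obj ⟨x⟩

variable {F}

/-- The result of moving `e` along `α`, as a point over the end point of `α`. -/
def moveAlong {x : X} (e : F.obj ⟨x⟩) (α : PathsFrom X x) : Total F :=
  ⟨α.1 1, act F α.toPath e⟩

/-- The finest topology for which all the maps `moveAlong e` on spaces of paths are
continuous. -/
instance : TopologicalSpace (Total F) :=
  ⨆ (x : X) (e : F.obj ⟨x⟩), TopologicalSpace.coinduced (moveAlong e) inferInstance

theorem isOpen_total_iff {N : Set (Total F)} :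
    IsOpen N ↔ ∀ (x : X) (e : F.obj ⟨x⟩), IsOpen (moveAlong e ⁻¹' N) := by
  simp only [isOpen_iSup_iff, isOpen_coinduced]

theorem continuous_moveAlong {x : X} (e : F.obj ⟨x⟩) : Continuous (moveAlong e) :=
  ⟨fun _ hN => isOpen_total_iff.1 hN x e⟩

theorem moveAlong_of_path {x x' : X} (α : Path x x') (e : F.obj ⟨x⟩) :
    moveAlong e ⟨α, α.source⟩ = (⟨x', act F α e⟩ : Total F) := by
  obtain ⟨α, h0, rfl⟩ := α
  rfl

variable (F) in
/-- The projection `∐ F(x) → X`. -/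
def proj : C(Total F, X) :=
  ⟨Sigma.fst, ⟨fun _ hV => isOpen_total_iff.2 fun _ _ => hV.preimage PathsFrom.continuous_end⟩⟩

theorem moveAlong_eq_iff {x x' : X} {e : F.obj ⟨x⟩} {e' : F.obj ⟨x'⟩} (q : PathCospan x x') :
    moveAlong e q.1.1 = moveAlong e' q.1.2 ↔ act F q.path e = e' := by
  obtain ⟨⟨⟨α, hα⟩, ⟨β, hβ⟩⟩, h : α 1 = β 1⟩ := q
  have key : ∀ (b : X) (γ : Path x b) (δ : Path x' b),
      (⟨b, act F γ e⟩ : Total F) = ⟨b, act F δ e'⟩ ↔ act F (γ.trans δ.symm) e = e' := by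
    intro b γ δ
    rw [act_trans]
    constructor
    · intro h
      rw [eq_of_heq (Sigma.mk.inj h).2, act_symm_act]
    · intro h
      rw [← h, act_act_symm]
  have := key (β 1) ⟨α, hα, h⟩ ⟨β, hβ, rfl⟩
  rw [← moveAlong_of_path, ← moveAlong_of_path] at this
  exact this

theorem moveAlong_injective {x : X} (α : PathsFrom X x) :
    Function.Injective fun e : F.obj ⟨x⟩ => moveAlong e α := fun _ _ h =>
  act_injective F α.toPath (eq_of_heq (Sigma.mk.inj h).2)

/-- If two paths move `e` and `e'` to the same point, then so do any two nearby paths with a common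
end point: the first path followed by the reverse of the second is a path from `x` to `x'`, and
the effect of such paths on `e` is locally constant. -/
theorem exists_moveAlong_eq (hF : IsTopFunctor (piTau X) setHomTopology F) {x x' : X}
    {e : F.obj ⟨x⟩} {e' : F.obj ⟨x'⟩} {α : PathsFrom X x} {α' : PathsFrom X x'}
    (h : moveAlong e α = moveAlong e' α') :
    ∃ O O', IsOpen O ∧ IsOpen O' ∧ α ∈ O ∧ α' ∈ O' ∧
      ∀ β ∈ O, ∀ β' ∈ O', β.1 1 = β'.1 1 → moveAlong e β = moveAlong e' β' := by
  have hS : IsOpen {q : PathCospan x x' | moveAlong e q.1.1 = moveAlong e' q.1.2} := by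
    simp only [moveAlong_eq_iff]
    exact (isOpen_act_eq hF e e').preimage PathCospan.continuous_path
  obtain ⟨S, hS, hSe⟩ := isOpen_induced_iff.1 hS
  have hαα' : (α, α') ∈ S := by
    have : (⟨(α, α'), (Sigma.mk.inj h).1⟩ : PathCospan x x') ∈ Subtype.val ⁻¹' S := by
      rw [hSe]
      exact h
    exact this
  obtain ⟨O, O', hO, hO', hα, hα', H⟩ := isOpen_prod_iff.1 hS α α' hαα'
  refine ⟨O, O', hO, hO', hα, hα', fun β hβ β' hβ' hb => ?_⟩
  have : (⟨(β, β'), hb⟩ : PathCospan x x') ∈ Subtype.val ⁻¹' S := H ⟨hβ, hβ'⟩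
  rw [hSe] at this
  exact this

/-- Every path has a neighbourhood in which `moveAlong e` depends only on the end point. -/
theorem exists_injOn_moveAlong (hF : IsTopFunctor (piTau X) setHomTopology F) {x : X}
    (e : F.obj ⟨x⟩) (α : PathsFrom X x) :
    ∃ O, IsOpen O ∧ α ∈ O ∧
      ∀ β ∈ O, ∀ β' ∈ O, β.1 1 = β'.1 1 → moveAlong e β = moveAlong e β' := by
  obtain ⟨O, O', hO, hO', hα, hα', H⟩ := exists_moveAlong_eq hF (rfl : moveAlong e α = _)
  exact ⟨O ∩ O', hO.inter hO', ⟨hα, hα'⟩, fun β hβ β' hβ' => H β hβ.1 β' hβ'.2⟩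

/-- The points to which `e` is moved along the paths in a small neighbourhood `O` of a locally
well-ended path `α` fill a neighbourhood of the point to which `α` moves it. The open set `N`
consists of those lying over a neighbourhood `V` of the end of `α`; it is open since each of its
points is also reached along a well-ended path in `O`. -/
theorem exists_isOpen_subset_moveAlong (hF : IsTopFunctor (piTau X) setHomTopology F) {x : X}
    {e : F.obj ⟨x⟩} {α : PathsFrom X x} (hα : IsLocallyWellEnded α.1) {O : Set (PathsFrom X x)}
    (hO : IsOpen O) (hαO : α ∈ O)
    (H : ∀ β ∈ O, ∀ β' ∈ O, β.1 1 = β'.1 1 → moveAlong e β = moveAlong e β') :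
    ∃ N, IsOpen N ∧ moveAlong e α ∈ N ∧ N ⊆ moveAlong e '' O := by
  obtain ⟨V, hV, hαV, HV⟩ := hα.exists_end hO hαO
  refine ⟨moveAlong e '' (O ∩ {β | β.1 1 ∈ V}), isOpen_total_iff.2 fun x' e' => ?_,
    ⟨α, ⟨hαO, hαV⟩, rfl⟩, Set.image_mono Set.inter_subset_left⟩
  refine isOpen_iff_mem_nhds.2 ?_
  rintro γ ⟨β, ⟨hβO, hβV⟩, hβγ⟩
  -- replace `β` by a well-ended path with the same end, so that each path `γ'` near `γ` has the
  -- end point of a path near it; this moves `e` to the same point as `γ'` moves `e'`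
  obtain ⟨β', hβ'O, hβ'w, hβ'⟩ := HV _ hβV
  have hβ'γ : moveAlong e β' = moveAlong e' γ := (H _ hβ'O _ hβO hβ').trans hβγ
  obtain ⟨Q, Q', hQ, hQ', hβQ, hγQ', HQ⟩ := exists_moveAlong_eq hF hβ'γ
  obtain ⟨V', hV', hβV', HV'⟩ := hβ'w.exists_end (hO.inter hQ) ⟨hβ'O, hβQ⟩
  have hγ : β'.1 1 = γ.1 1 := (Sigma.mk.inj hβ'γ).1
  have hγV : γ.1 1 ∈ V' ∩ V := ⟨hγ ▸ hβV', hγ ▸ hβ' ▸ hβV⟩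
  filter_upwards [hQ'.mem_nhds hγQ',
    ((hV'.inter hV).preimage PathsFrom.continuous_end).mem_nhds hγV] with γ' hγ'Q hγ'V
  obtain ⟨δ, ⟨hδO, hδQ⟩, hδ⟩ := HV' _ hγ'V.1
  refine ⟨δ, ⟨hδO, ?_⟩, HQ _ hδQ _ hγ'Q hδ⟩
  rw [Set.mem_ofPred_eq, hδ]
  exact hγ'V.2

/-- A single locally well-ended path reaches all points of a given fibre of `∐ F(x)`. -/
theorem exists_isLocallyWellEnded (hX : LocallyWepConnected X) (x : X) :
    ∃ α : PathsFrom X x, IsLocallyWellEnded α.1 ∧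
      ∀ e : F.obj ⟨x⟩, ∃ e₀ : F.obj ⟨x⟩, moveAlong e₀ α = (⟨x, e⟩ : Total F) := by
  obtain ⟨α, hα, h0, h1⟩ := hX x x
  refine ⟨⟨α, h0⟩, hα, fun e => ⟨act F (Path.symm ⟨α, h0, h1⟩) e, ?_⟩⟩
  have := moveAlong_of_path (F := F) ⟨α, h0, h1⟩ (act F (Path.symm ⟨α, h0, h1⟩) e)
  rwa [act_act_symm] at this

theorem isOpenMap_proj (hX : LocallyWepConnected X) : IsOpenMap (proj F) := by
  intro N hN
  refine isOpen_iff_mem_nhds.2 ?_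
  rintro _ ⟨⟨x, e⟩, he, rfl⟩
  obtain ⟨α, hα, H⟩ := exists_isLocallyWellEnded (F := F) hX x
  obtain ⟨e₀, he₀⟩ := H e
  obtain ⟨V, hV, hαV, HV⟩ := hα.isWellEnded.exists_end (hN.preimage (continuous_moveAlong e₀))
    (by rwa [Set.mem_preimage, he₀])
  have hx : α.1 1 = x := (Sigma.mk.inj he₀).1
  rw [hx] at hαV
  refine Filter.mem_of_superset (hV.mem_nhds hαV) fun b hb => ?_
  obtain ⟨β, hβ, hβb⟩ := HV b hb
  exact ⟨_, hβ, hβb⟩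

theorem isLocallyInjective_proj (hX : LocallyWepConnected X)
    (hF : IsTopFunctor (piTau X) setHomTopology F) : IsLocallyInjective (proj F) := by
  rintro ⟨x, e⟩
  obtain ⟨α, hα, H⟩ := exists_isLocallyWellEnded (F := F) hX x
  obtain ⟨e₀, he₀⟩ := H e
  obtain ⟨O, hO, hαO, HO⟩ := exists_injOn_moveAlong hF e₀ α
  obtain ⟨N, hN, hαN, hNO⟩ := exists_isOpen_subset_moveAlong hF hα hO hαO HO
  refine ⟨N, hN, he₀ ▸ hαN, fun z hz z' hz' h => ?_⟩
  obtain ⟨β, hβ, rfl⟩ := hNO hz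
  obtain ⟨β', hβ', rfl⟩ := hNO hz'
  exact HO _ hβ _ hβ' h

theorem isSeparatedMap_proj (hX : LocallyWepConnected X)
    (hF : IsTopFunctor (piTau X) setHomTopology F) : IsSeparatedMap (proj F) := by
  rintro ⟨x, e⟩ ⟨x', e'⟩ (rfl : x = x') hne
  obtain ⟨α, hα, H⟩ := exists_isLocallyWellEnded (F := F) hX x
  obtain ⟨e₀, he₀⟩ := H e
  obtain ⟨e₁, he₁⟩ := H e'
  obtain ⟨O₀, hO₀, hαO₀, HO₀⟩ := exists_injOn_moveAlong hF e₀ α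
  obtain ⟨O₁, hO₁, hαO₁, HO₁⟩ := exists_injOn_moveAlong hF e₁ α
  obtain ⟨N, hN, hαN, hNO⟩ := exists_isOpen_subset_moveAlong hF hα hO₀ hαO₀ HO₀
  obtain ⟨N', hN', hαN', hNO'⟩ := exists_isOpen_subset_moveAlong hF hα
    (hO₀.inter hO₁) ⟨hαO₀, hαO₁⟩ fun β hβ β' hβ' => HO₁ β hβ.2 β' hβ'.2
  refine ⟨N, N', hN, hN', he₀ ▸ hαN, he₁ ▸ hαN', Set.disjoint_left.2 fun z hz hz' => hne ?_⟩
  obtain ⟨β, hβ, rfl⟩ := hNO hz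
  obtain ⟨β', hβ', h⟩ := hNO' hz'
  -- both points are moved to `z` along `β'`
  have : moveAlong e₁ β' = moveAlong e₀ β' :=
    h.trans (HO₀ _ hβ _ hβ'.1 (Sigma.mk.inj h).1.symm)
  rw [← he₀, ← he₁, moveAlong_injective β' this]

theorem isLocalHomeomorph_proj (hX : LocallyWepConnected X)
    (hF : IsTopFunctor (piTau X) setHomTopology F) : IsLocalHomeomorph (proj F) := by
  refine isLocalHomeomorph_iff_isOpenEmbedding_restrict.2 fun z => ?_
  obtain ⟨N, hN, hz, hinj⟩ := isLocallyInjective_proj hX hF z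
  refine ⟨N, hN.mem_nhds hz, .of_continuous_injective_isOpenMap
    ((proj F).continuous.comp continuous_subtype_val) hinj.injective
    ((isOpenMap_proj hX).comp hN.isOpenMap_subtype_val)⟩

end FundamentalGroupoid

/-! ### Continuous lifting of paths and of homotopies -/

namespace FundamentalGroupoid

variable {X : Type u} [TopologicalSpace X] {F : FundamentalGroupoid X ⥤ Type u}

theorem moveAlong_eq_self {x : X} (e : F.obj ⟨x⟩) {α : PathsFrom X x} (hα : ∀ t, α.1 t = x) :
    moveAlong e α = (⟨x, e⟩ : Total F) := by
  have h := moveAlong_of_path (Path.refl x) e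
  rw [act_refl] at h
  rw [← h]
  exact congrArg _ (Subtype.ext (ContinuousMap.ext hα))

/-- Let `c` contract `K` into a subset `A`, keeping `A` inside itself. Then composition with the
projection `∐ F(x) → X` is a homeomorphism from the space of maps on `K` that are constant on `A`
with value `⟨x, e⟩` to the space of those with value `x`. A map `φ` is lifted by moving `e` along
the paths `u ↦ φ (c (u, k))`; the predicates `P` and `Q` describe the two spaces of maps. -/
theorem isHomeomorph_comp_proj (hX : LocallyWepConnected X)
    (hF : IsTopFunctor (piTau X) setHomTopology F) {x : X} (e : F.obj ⟨x⟩)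
    {K : Type*} [TopologicalSpace K] [LocallyCompactSpace K] {A : Set K} (c : C(I × K, K))
    (hc0 : ∀ k, c (0, k) ∈ A) (hc1 : ∀ k, c (1, k) = k) (hcA : ∀ u, ∀ k ∈ A, c (u, k) ∈ A)
    {P : C(K, Total F) → Prop} {Q : C(K, X) → Prop}
    (hP : ∀ φ, P φ ↔ ∀ a ∈ A, φ a = (⟨x, e⟩ : Total F)) (hQ : ∀ φ, Q φ ↔ ∀ a ∈ A, φ a = x)
    (m : {φ // P φ} → {φ // Q φ}) (hm : ∀ φ, (m φ).1 = (proj F).comp φ.1) : IsHomeomorph m := by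
  have hmc : Continuous m := by
    refine continuous_induced_rng.2 ?_
    have : Continuous fun φ : {φ // P φ} => (proj F).comp φ.1 :=
      (ContinuousMap.continuous_postcomp _).comp continuous_subtype_val
    exact this.congr fun φ => (hm φ).symm
  have hmi : Function.Injective m := by
    intro φ ψ h
    refine Subtype.ext (ContinuousMap.ext fun k => ?_)
    have h' : (proj F).comp φ.1 = (proj F).comp ψ.1 := by rw [← hm, ← hm, h]
    have := (isSeparatedMap_proj hX hF).eq_of_comp_eq (isLocallyInjective_proj hX hF)
      (g₁ := fun u : I => φ.1 (c (u, k))) (g₂ := fun u : I => ψ.1 (c (u, k)))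
      (by fun_prop) (by fun_prop) (funext fun u => DFunLike.congr_fun h' (c (u, k))) 0
      (((hP _).1 φ.2 _ (hc0 k)).trans ((hP _).1 ψ.2 _ (hc0 k)).symm)
    simpa only [hc1] using congrFun this 1
  let γ (z : {φ // Q φ} × K) : PathsFrom X x :=
    ⟨⟨fun u => z.1.1 (c (u, z.2)), by fun_prop⟩, (hQ _).1 z.1.2 _ (hc0 _)⟩
  have hγ : Continuous γ := by
    refine Continuous.subtype_mk (ContinuousMap.continuous_of_continuous_uncurry _ ?_) _
    change Continuous fun z : ({φ // Q φ} × K) × I => z.1.1.1 (c (z.2, z.1.2))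
    fun_prop
  let L : C({φ // Q φ}, C(K, Total F)) :=
    ContinuousMap.curry ⟨fun z => moveAlong e (γ z), (continuous_moveAlong e).comp hγ⟩
  have hL : ∀ φ, P (L φ) := fun φ => (hP _).2 fun a ha =>
    moveAlong_eq_self e fun u => (hQ _).1 φ.2 _ (hcA u a ha)
  have hmL : Function.RightInverse (fun φ => ⟨L φ, hL φ⟩) m := fun φ => by
    refine Subtype.ext ?_
    rw [hm]
    refine ContinuousMap.ext fun k => ?_
    change φ.1 (c (1, k)) = φ.1 k
    rw [hc1]
  exact Homeomorph.isHomeomorph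
    { toFun := m
      invFun := fun φ => ⟨L φ, hL φ⟩
      left_inv := hmL.leftInverse_of_injective hmi
      right_inv := hmL
      continuous_toFun := hmc
      continuous_invFun := L.continuous.subtype_mk _ }

theorem isSemicovering_proj (hX : LocallyWepConnected X)
    (hF : IsTopFunctor (piTau X) setHomTopology F) : IsSemicovering (proj F) := by
  refine ⟨isLocalHomeomorph_proj hX hF, fun ⟨x, e⟩ => ?_, fun ⟨x, e⟩ => ?_⟩
  · refine isHomeomorph_comp_proj hX hF e (A := {0}) ⟨fun z => z.1 * z.2, by fun_prop⟩
      (fun k => ?_) (fun k => ?_) (fun u k hk => ?_) (fun φ => ?_) (fun φ => ?_) _ fun _ => rfl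
    · exact zero_mul k
    · exact one_mul k
    · obtain rfl : k = 0 := hk
      exact mul_zero u
    · simp
    · change φ 0 = x ↔ _
      simp
  · have : CompactSpace simplexTwo := by
      refine isCompact_iff_compactSpace.1 (IsClosed.isCompact ?_)
      exact isClosed_le (by fun_prop) continuous_const
    have h (z : I × simplexTwo) : (z.1 * z.2.1.1, z.2.1.2) ∈ simplexTwo := by
      have h : (z.2.1.1 : ℝ) + z.2.1.2 ≤ 1 := z.2.2
      have h' : (z.1 : ℝ) * z.2.1.1 ≤ z.2.1.1 :=
        mul_le_of_le_one_left z.2.1.1.2.1 z.1.2.2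
      change ((z.1 * z.2.1.1 : I) : ℝ) + z.2.1.2 ≤ 1
      push_cast
      linarith
    refine isHomeomorph_comp_proj hX hF e (A := {z : simplexTwo | z.1.1 = 0})
      ⟨fun z => ⟨(z.1 * z.2.1.1, z.2.1.2), h z⟩, by fun_prop⟩
      (fun k => ?_) (fun k => ?_) (fun u k hk => ?_) (fun φ => Iff.rfl) (fun φ => Iff.rfl) _
      fun _ => rfl
    · exact zero_mul k.1.1
    · exact Subtype.ext (Prod.ext (one_mul k.1.1) rfl)
    · change u * k.1.1 = 0
      rw [show k.1.1 = 0 from hk, mul_zero]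

/-- The monodromy of `∐ F(x) → X` is given by `F`. -/
theorem liftEnd_proj (hp : IsSemicovering (proj F)) {x x' : X} (α : Path x x') (e : F.obj ⟨x⟩) :
    hp.liftEnd α ⟨⟨x, e⟩, rfl⟩ = ⟨⟨x', act F α e⟩, rfl⟩ := by
  let γ (t : I) : PathsFrom X x := ⟨⟨fun u => α (u * t), by fun_prop⟩, by simp⟩
  have hγ : Continuous γ := by
    refine Continuous.subtype_mk (ContinuousMap.continuous_of_continuous_uncurry _ ?_) _
    change Continuous fun z : I × I => α (z.2 * z.1)
    fun_prop
  have h := hp.eq_lift ⟨⟨x, e⟩, rfl⟩ α (γ := ⟨fun t => moveAlong e (γ t),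
    (continuous_moveAlong e).comp hγ⟩) (moveAlong_eq_self e fun u => by simp [γ])
    fun t => congrArg α (one_mul t)
  refine Subtype.ext ((DFunLike.congr_fun h 1).trans (Eq.trans ?_ (moveAlong_of_path α e)))
  exact congrArg (moveAlong e) (Subtype.ext (ContinuousMap.ext fun u => congrArg α (mul_one u)))

end FundamentalGroupoid

/-! ### Monodromy is an isomorphism of categories -/

section Monodromy

variable {X : Type u} [TopologicalSpace X]

instance SCov.faithful_monodromy : (monodromy X).Faithful where
  map_injective {p q} f g h := by
    refine SCov.Hom.ext (ContinuousMap.ext fun y => ?_)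
    have h' := congrArg (fun η : (monodromy X).obj p ⟶ (monodromy X).obj q =>
      η.hom.app ⟨p.proj y⟩) h
    exact congrArg Subtype.val (ConcreteCategory.congr_hom h' (⟨y, rfl⟩ : p.proj ⁻¹' {p.proj y}))

theorem SCov.full_monodromy (hX : LocallyWepConnected X) : (monodromy X).Full where
  map_surjective {p q} η := by
    let g (x : X) (y : p.proj ⁻¹' {x}) : q.proj ⁻¹' {x} := η.hom.app ⟨x⟩ y
    let f (y : p.space) : q.proj ⁻¹' {p.proj y} := g (p.proj y) ⟨y, rfl⟩
    have hf : ∀ {x : X} (y : p.proj ⁻¹' {x}), (f y : q.space) = g x y := by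
      rintro x ⟨y, rfl⟩
      rfl
    have hc : Continuous fun y => (f y : q.space) :=
      p.isSemicovering.continuous_of_map_liftEnd hX q.isSemicovering (fun y => (f y).2)
        fun x x' α y => by
          have := NatTrans.naturality_apply η.hom (X := ⟨x⟩) (Y := ⟨x'⟩)
            (Path.Homotopic.Quotient.mk α) y
          refine ((hf _).trans (congrArg Subtype.val this)).trans ?_
          exact congrArg (fun w => (q.isSemicovering.liftEnd α w : q.space))
            (Subtype.ext (hf y).symm)
    refine ⟨⟨⟨_, hc⟩, fun y => (f y).2⟩, ?_⟩
    refine ObjectProperty.hom_ext _ (NatTrans.ext (funext fun x => ?_))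
    refine ConcreteCategory.hom_ext _ _ fun y => ?_
    exact Subtype.ext (hf y)

namespace SCovFamily

theorem coe_liftEnd (E : SCovFamily X) {x x' : X} (α : Path x x') (e : E.fiber x) :
    (E.toSCov.isSemicovering.liftEnd α (E.fiberEquiv x e) : E.toSCov.space) =
      (⟨x', E.monodromyFunctor.map (X := ⟨x⟩) (Y := ⟨x'⟩) (Path.Homotopic.Quotient.mk α) e⟩ :
        Σ x, E.fiber x) :=
  congrArg Subtype.val ((E.fiberEquiv x').apply_symm_apply
    (E.toSCov.isSemicovering.liftEnd α (E.fiberEquiv x e))).symm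

/-- The semicovering `∐ F(x) → X`. -/
def ofTopFunctor (hX : LocallyWepConnected X) (F : TopFuncPi X) : SCovFamily X where
  fiber x := F.obj.obj ⟨x⟩
  top := inferInstanceAs (TopologicalSpace (FundamentalGroupoid.Total F.obj))
  continuous_fst := (FundamentalGroupoid.proj F.obj).continuous
  isSemicovering := FundamentalGroupoid.isSemicovering_proj hX F.property

theorem monodromyObj_ofTopFunctor (hX : LocallyWepConnected X) (F : TopFuncPi X) :
    (ofTopFunctor hX F).monodromyObj = F := by
  obtain ⟨F, hF⟩ := F
  have : (ofTopFunctor hX ⟨F, hF⟩).monodromyFunctor = F := by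
    refine Functor.hext (fun _ => rfl) fun x x' a => heq_of_eq ?_
    induction a using Path.Homotopic.Quotient.ind with | _ α
    refine ConcreteCategory.hom_ext _ _ fun e => ?_
    have h := (ofTopFunctor hX ⟨F, hF⟩).coe_liftEnd α e
    have h' := congrArg Subtype.val (FundamentalGroupoid.liftEnd_proj
      (FundamentalGroupoid.isSemicovering_proj hX hF) α e)
    exact eq_of_heq (Sigma.mk.inj (h.symm.trans h')).2
  exact ObjectProperty.FullSubcategory.ext this

theorem injective_monodromyObj (hX : LocallyWepConnected X) :
    Function.Injective (monodromyObj : SCovFamily X → TopFuncPi X) := by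
  have le : ∀ {fiber : X → Type u} {t t' c c' s s'},
      (mk fiber t c s).monodromyFunctor = (mk fiber t' c' s').monodromyFunctor → t ≤ t' := by
    intro fiber t t' c c' s s' h
    refine continuous_id_iff_le.1 ?_
    refine (mk fiber t c s).toSCov.isSemicovering.continuous_of_map_liftEnd hX
      (mk fiber t' c' s').toSCov.isSemicovering (f := id) (fun _ => rfl) ?_
    rintro x x' α ⟨⟨_, e⟩, rfl⟩
    refine ((mk fiber t c s).coe_liftEnd α e).trans
      (Eq.trans ?_ ((mk fiber t' c' s').coe_liftEnd α e).symm)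
    have := Functor.congr_hom h (X := ⟨_⟩) (Y := ⟨x'⟩) (Path.Homotopic.Quotient.mk α)
    rw [this]
    rfl
  rintro ⟨fiber, t, c, s⟩ ⟨fiber', t', c', s'⟩ h
  have h' := congrArg ObjectProperty.FullSubcategory.obj h
  obtain rfl : fiber = fiber' := funext fun x => Functor.congr_obj h' ⟨x⟩
  obtain rfl : t = t' := le_antisymm (le h') (le h'.symm)
  rfl

end SCovFamily

end Monodromy

theorem theorem5p1 (X : Type u) [TopologicalSpace X] (hX : LocallyWepConnected X) :
    (monodromy X).IsEquivalence ∧ (SCovFamily.monodromy X).IsIso := by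
  have full := SCov.full_monodromy hX
  have obj : ∀ F : TopFuncPi X, ∃ E : SCovFamily X, E.monodromyObj = F := fun F =>
    ⟨_, SCovFamily.monodromyObj_ofTopFunctor hX F⟩
  constructor
  · have : (monodromy X).EssSurj := ⟨fun F => by
      obtain ⟨E, rfl⟩ := obj F
      exact ⟨E.toSCov, ⟨ObjectProperty.isoMk _ E.monodromyFunctorIso⟩⟩⟩
    exact { }
  · have : (SCovFamily.inclusion X).Full := inferInstanceAs (inducedFunctor _).Full
    have : (SCovFamily.inclusion X).Faithful := inferInstanceAs (inducedFunctor _).Faithful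
    have i : SCovFamily.inclusion X ⋙ monodromy X ≅ SCovFamily.monodromy X :=
      (SCovFamily.inclusion X ⋙ monodromy X).isoCopyObj _ _
    exact
      { full := .of_iso i
        faithful := .of_iso i
        bijective_obj := ⟨SCovFamily.injective_monodromyObj hX, obj⟩ }
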